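/- Let $\mathcal H$ be a complex Hilbert space, let $0<m<M$ be real numbers, and let $A,B\in\mathcal B(\mathcal H)$ satisfy $mI\le A\le MI$ and $mI\le B\le MI$. Let $v\in[0,1]$. For positive invertible operators $X,Y$ (in particular, for positive real numbers) put $$X\nabla_vY=(1-v)X+vY,\qquad X\,!_v\,Y=\big((1-v)X^{-1}+vY^{-1}\big)^{-1},$$ and for real $a,b>0$ put $a\,\sharp_v\,b=a^{1-v}b^v$. Let $\sigma_v$ and $\tau_v$ be operator means in the sense of Kubo and Ando on the positive operators of $\mathcal B(\mathcal H)$ (binary operations that are jointly monotone, satisfy the transformer inequality $C(X\sigma Y)C\le (CXC)\sigma(CYC)$ for all $C\ge 0$, are continuous from above in the strong operator topology, and satisfy $I\sigma I=I$) that lie between the harmonic and the arithmetic mean, i.e. $X\,!_v\,Y\le X\sigma_vY\le X\nabla_vY$ and $X\,!_v\,Y\le X\tau_vY\le X\nabla_vY$ for all positive invertible $X,Y\in\mathcal B(\mathcal H)$. For $a,b>0$ define $$L(a,b)=\frac{(a\nabla_\lambda b)\,(a\,\sharp_\mu\, b)}{(a\,\sharp_\lambda\, b)\,(a\,!_\mu\,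 b)},\qquad \lambda=\min\{v,1-v\},\quad \mu=\max\{v,1-v\}.$$ Then, with $\|\cdot\|$ the operator norm, for every real $p>1$, $$\|A\sigma_vB\|^p\le L(m^p,M^p)\,\|A^p\tau_vB^p\|\qquad\text{and}\qquad \|A^p\sigma_vB^p\|\le L(m^p,M^p)\,\|A\tau_vB\|^p .$$ -/

import Mathlib

open Filter Topology

namespace OpMean

noncomputable section

/-- The weighted arithmetic mean `a ∇_v b = (1 - v) a + v b` of real numbers. -/
def scalarArith (v a b : ℝ) : ℝ := (1 - v) * a + v * b

/-- The weighted geometric mean `a ♯_v b = a ^ (1 - v) b ^ v` of positive real numbers. -/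
def scalarGeom (v a b : ℝ) : ℝ := a ^ (1 - v) * b ^ v

/-- The weighted harmonic mean `a !_v b = ((1 - v) a⁻¹ + v b⁻¹)⁻¹` of positive real numbers. -/
def scalarHarm (v a b : ℝ) : ℝ := ((1 - v) * a⁻¹ + v * b⁻¹)⁻¹

/-- The constant `L(m, M) = ((m ∇_l M) (m ♯_u M)) / ((m ♯_l M) (m !_u M))`, where
`l = min {v, 1 - v}` and `u = max {v, 1 - v}`. -/
def constL (v m M : ℝ) : ℝ :=
  (scalarArith (min v (1 - v)) m M * scalarGeom (max v (1 - v)) m M) /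
    (scalarGeom (min v (1 - v)) m M * scalarHarm (max v (1 - v)) m M)

variable {H : Type*} [NormedAddCommGroup H] [InnerProductSpace ℂ H]

/-- The weighted arithmetic mean `A ∇_v B = (1 - v) A + v B` of operators. -/
def arith (v : ℝ) (A B : H →L[ℂ] H) : H →L[ℂ] H := (1 - v) • A + v • B

/-- The weighted harmonic mean `A !_v B = ((1 - v) A⁻¹ + v B⁻¹)⁻¹` of positive invertible
operators. -/
def harm (v : ℝ) (A B : H →L[ℂ] H) : H →L[ℂ] H :=
  Ring.inverse ((1 - v) • Ring.inverse A + v • Ring.inverse B)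

/-- An operator mean on `B(H)` in the sense of Kubo and Ando: a binary operation on the positive
operators (the values at other arguments are irrelevant) which is monotone in both arguments,
satisfies the transformer inequality, is continuous from above for the strong operator
topology, and is normalized. The order is the Loewner order. -/
structure IsOperatorMean (σ : (H →L[ℂ] H) → (H →L[ℂ] H) → (H →L[ℂ] H)) : Prop where
  nonneg : ∀ A B : H →L[ℂ] H, 0 ≤ A → 0 ≤ B → 0 ≤ σ A B
  mono : ∀ A B C D : H →L[ℂ] H, 0 ≤ A → 0 ≤ B → A ≤ C → B ≤ D → σ A B ≤ σ C D
  transformer : ∀ A B C : H →L[ℂ] H, 0 ≤ A → 0 ≤ B → 0 ≤ C →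
    C * σ A B * C ≤ σ (C * A * C) (C * B * C)
  continuous_from_above : ∀ (A B : ℕ → H →L[ℂ] H) (A' B' : H →L[ℂ] H),
    (∀ n, 0 ≤ A n) → (∀ n, 0 ≤ B n) → Antitone A → Antitone B →
    (∀ x : H, Tendsto (fun n => A n x) atTop (𝓝 (A' x))) →
    (∀ x : H, Tendsto (fun n => B n x) atTop (𝓝 (B' x))) →
    ∀ x : H, Tendsto (fun n => σ (A n) (B n) x) atTop (𝓝 (σ A' B' x))
  normalized : σ 1 1 = 1

/-- The operation `σ` lies between the `v`-weighted harmonic and arithmetic means: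
`A !_v B ≤ A σ B ≤ A ∇_v B` for all positive invertible `A`, `B`. -/
def IsBetweenHarmArith (v : ℝ) (σ : (H →L[ℂ] H) → (H →L[ℂ] H) → (H →L[ℂ] H)) : Prop :=
  ∀ A B : H →L[ℂ] H, 0 ≤ A → IsUnit A → 0 ≤ B → IsUnit B →
    harm v A B ≤ σ A B ∧ σ A B ≤ arith v A B

end

end OpMean

/-!
Both inequalities compare an operator mean with the harmonic and the arithmetic mean, so they
follow from three facts about `X ∇ Y = arith v X Y` and `X ! Y = harm v X Y`.

* Raising to the power `p ≥ 1` increases the norm of the arithmetic mean and decreases the norm of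
  the harmonic mean: `‖A ∇ B‖ ^ p ≤ ‖A ^ p ∇ B ^ p‖` and `‖A ^ p ! B ^ p‖ ≤ ‖A ! B‖ ^ p`
  (`norm_arith_rpow_le`, `norm_harm_rpow_le`). Although `t ↦ t ^ p` is in general not operator
  convex, the tangent line bound `A ^ p ≥ (1 - p) c ^ p + p c ^ (p - 1) A` (`tangent_le_rpow`) is
  an operator inequality which is affine in `A`. It can therefore be averaged over `A` and `B`,
  with `c` the norm of `A ∇ B` in the first case and the lower bound `‖A ! B‖⁻¹` of
  `A⁻¹ ∇ B⁻¹` in the second.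
* If `X ≤ h Y` and `Y ≤ h X`, then `X ∇ Y ≤ K (X ! Y)` with
  `K = (1 - v) ^ 2 + v ^ 2 + v (1 - v) (h + h⁻¹)` (`arith_le_smul_harm`). With `S = X ∇ Y` and
  `W = X⁻¹ ∇ Y⁻¹` this amounts to `S W S ≤ K S`, and on expanding the left side only the terms
  `X Y⁻¹ X` and `Y X⁻¹ Y` have to be estimated (`mul_inverse_mul_add_le`).
* For `X = A ^ p` and `Y = B ^ p` one can take `h = M ^ p / m ^ p`, and then `K` is at most
  `constL v (m ^ p) (M ^ p)` (`kantorovich_le_constL`).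

Applied in the order `∇`, power, `!` these facts give the first inequality, and in the order
`∇`, `!`, power the second.
-/

namespace OpMean

/-! ### Scalar inequalities -/

/-- With `h = exp (2 s)` and `d = 1 - 2 l` this is `artanh (d * tanh s) ≤ d * s`. -/
lemma affine_le_affine_mul_rpow {l h : ℝ} (hl : 0 ≤ l) (hl2 : l ≤ 1 / 2) (hh : 1 ≤ h) :
    (1 - l) * h + l ≤ (l * h + (1 - l)) * h ^ (1 - 2 * l) := by
  have pos1 : ∀ x : ℝ, 1 ≤ x → 0 < l * x + (1 - l) := fun x hx => by nlinarith
  have pos2 : ∀ x : ℝ, 1 ≤ x → 0 < (1 - l) * x + l := fun x hx => by nlinarith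
  let f : ℝ → ℝ := fun x =>
    Real.log (l * x + (1 - l)) + (1 - 2 * l) * Real.log x - Real.log ((1 - l) * x + l)
  have hd : ∀ x : ℝ, 1 ≤ x → HasDerivAt f
      (l / (l * x + (1 - l)) + (1 - 2 * l) * x⁻¹ - (1 - l) / ((1 - l) * x + l)) x := by
    intro x hx
    have h1 : HasDerivAt (fun x : ℝ => l * x + (1 - l)) l x := by
      simpa using ((hasDerivAt_id x).const_mul l).add_const (1 - l)
    have h2 : HasDerivAt (fun x : ℝ => (1 - l) * x + l) (1 - l) x := by
      simpa using ((hasDerivAt_id x).const_mul (1 - l)).add_const l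
    exact ((h1.log (pos1 x hx).ne').add
      ((Real.hasDerivAt_log (by linarith : x ≠ 0)).const_mul (1 - 2 * l))).sub
      (h2.log (pos2 x hx).ne')
  have hmono : MonotoneOn f (Set.Ici 1) := by
    apply monotoneOn_of_deriv_nonneg (convex_Ici 1)
    · exact fun x hx => (hd x hx).continuousAt.continuousWithinAt
    · intro x hx
      rw [interior_Ici] at hx
      exact (hd x (le_of_lt hx)).differentiableAt.differentiableWithinAt
    · intro x hx
      rw [interior_Ici] at hx
      have hx1 : (1 : ℝ) ≤ x := le_of_lt hx
      rw [(hd x hx1).deriv]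
      have p1 := pos1 x hx1
      have p2 := pos2 x hx1
      have hx0 : 0 < x := by linarith
      have e : l / (l * x + (1 - l)) + (1 - 2 * l) * x⁻¹ - (1 - l) / ((1 - l) * x + l)
          = (1 - 2 * l) * (l * (1 - l)) * (x - 1) ^ 2 /
            (x * (l * x + (1 - l)) * ((1 - l) * x + l)) := by
        rw [div_add' _ _ _ p1.ne', div_sub_div _ _ p1.ne' p2.ne', div_eq_div_iff (by positivity)
          (by positivity)]
        field_simp
        ring
      rw [e]
      have : 0 ≤ 1 - 2 * l := by linarith
      have : 0 ≤ 1 - l := by linarith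
      positivity
  have h1 : f 1 ≤ f h := hmono (Set.mem_Ici.2 le_rfl) (Set.mem_Ici.2 hh) hh
  have hh0 : 0 < h := by linarith
  have h2 : f 1 = 0 := by simp [f]
  rw [← Real.log_le_log_iff (pos2 h hh) (mul_pos (pos1 h hh) (Real.rpow_pos_of_pos hh0 _)),
    Real.log_mul (pos1 h hh).ne' (Real.rpow_pos_of_pos hh0 _).ne', Real.log_rpow hh0]
  simp only [f] at h1 h2
  linarith

lemma kantorovich_le_of_le_half {l a b : ℝ} (ha : 0 < a) (hab : a ≤ b) (hl : 0 ≤ l)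
    (hl2 : l ≤ 1 / 2) :
    (1 - l) ^ 2 + l ^ 2 + l * (1 - l) * (b / a + (b / a)⁻¹) ≤
      (scalarArith l a b * scalarGeom (1 - l) a b) /
        (scalarGeom l a b * scalarHarm (1 - l) a b) := by
  have hb : 0 < b := lt_of_lt_of_le ha hab
  have key := affine_le_affine_mul_rpow hl hl2 ((one_le_div ha).2 hab)
  have hS : 0 < (1 - l) * a + l * b := by nlinarith
  have hg : scalarGeom (1 - l) a b / scalarGeom l a b = (b / a) ^ (1 - 2 * l) := by
    unfold scalarGeom
    rw [Real.div_rpow hb.le ha.le, div_eq_div_iff (by positivity) (by positivity)]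
    calc a ^ (1 - (1 - l)) * b ^ (1 - l) * a ^ (1 - 2 * l)
        = (a ^ (1 - (1 - l)) * a ^ (1 - 2 * l)) * b ^ (1 - l) := by ring
      _ = a ^ (1 - l) * b ^ ((1 - 2 * l) + l) := by
        rw [← Real.rpow_add ha]; congr 2 <;> ring
      _ = _ := by rw [Real.rpow_add hb]; ring
  have e : (scalarArith l a b * scalarGeom (1 - l) a b) /
        (scalarGeom l a b * scalarHarm (1 - l) a b)
      = ((1 - l) * a + l * b) * (((l * (b / a) + (1 - l)) * (b / a) ^ (1 - 2 * l)) / b) := by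
    rw [mul_comm (scalarArith l a b), mul_div_mul_comm, hg]
    unfold scalarArith scalarHarm
    rw [div_eq_mul_inv _ (_)⁻¹]
    field_simp
    ring
  rw [e]
  calc (1 - l) ^ 2 + l ^ 2 + l * (1 - l) * (b / a + (b / a)⁻¹)
      = ((1 - l) * a + l * b) * (((1 - l) * (b / a) + l) / b) := by field_simp; ring
    _ ≤ _ := by gcongr

/-- The number on the left is `(a ∇_v b) / (a !_v b)`. It is the best constant `K` in
`X ∇_v Y ≤ K (X !_v Y)` for `a ≤ X, Y ≤ b`, and `constL` is never smaller. -/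
lemma kantorovich_le_constL {v a b : ℝ} (ha : 0 < a) (hab : a ≤ b) (hv : v ∈ Set.Icc (0 : ℝ) 1) :
    (1 - v) ^ 2 + v ^ 2 + v * (1 - v) * (b / a + (b / a)⁻¹) ≤ constL v a b := by
  unfold constL
  rcases le_total v (1 / 2) with h | h
  · rw [min_eq_left (by linarith), max_eq_right (by linarith)]
    exact kantorovich_le_of_le_half ha hab hv.1 h
  · rw [min_eq_right (by linarith), max_eq_left (by linarith)]
    have := kantorovich_le_of_le_half (l := 1 - v) ha hab (by linarith [hv.2]) (by linarith)
    rw [sub_sub_cancel] at this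
    linarith

/-! ### Order inequalities in C⋆-algebras -/

section CStarAlgebra

lemma ringInverse_smul {R : Type*} [Ring R] [Algebra ℝ R] {a : R} {c : ℝ} (hc : c ≠ 0)
    (ha : IsUnit a) : Ring.inverse (c • a) = c⁻¹ • Ring.inverse a := by
  refine Ring.inverse_unit (⟨c • a, c⁻¹ • Ring.inverse a, ?_, ?_⟩ : Rˣ)
  · rw [smul_mul_smul_comm, mul_inv_cancel₀ hc, Ring.mul_inverse_cancel _ ha, one_smul]
  · rw [smul_mul_smul_comm, inv_mul_cancel₀ hc, Ring.inverse_mul_cancel _ ha, one_smul]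

variable {𝓐 : Type*} [CStarAlgebra 𝓐] [PartialOrder 𝓐] [StarOrderedRing 𝓐]

lemma ringInverse_rpow {A : 𝓐} (hA : IsStrictlyPositive A) {p : ℝ} (hp : p ≠ 0) :
    Ring.inverse (A ^ p) = Ring.inverse A ^ p := by
  obtain ⟨u, rfl⟩ := hA.isUnit
  rw [CFC.inverse_rpow _ p hp hA, CFC.rpow_neg u p hA.nonneg, Ring.inverse_unit]

/-- The Schur complement of `[[P, P], [P, N]]` is nonnegative. -/
lemma mul_inverse_mul_le {P N : 𝓐} (hP : 0 ≤ P) (hN : IsStrictlyPositive N) (h : P ≤ N) :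
    P * Ring.inverse N * P ≤ P := by
  set R := Ring.inverse N with hR
  have hRs : IsSelfAdjoint R := hN.ringInverse.isSelfAdjoint
  have hPs : IsSelfAdjoint P := hP.isSelfAdjoint
  have hRN : R * N = 1 := Ring.inverse_mul_cancel _ hN.isUnit
  have h1 : 0 ≤ star (1 - R * P) * P * (1 - R * P) := star_left_conjugate_nonneg hP _
  have h2 : 0 ≤ star (R * P) * (N - P) * (R * P) :=
    star_left_conjugate_nonneg (sub_nonneg.2 h) _
  rw [star_sub, star_one, star_mul, hRs.star_eq, hPs.star_eq] at h1
  rw [star_mul, hRs.star_eq, hPs.star_eq] at h2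
  have h3 : P * R * (N - P) * (R * P) = P * R * P - P * R * P * R * P := by
    calc P * R * (N - P) * (R * P) = P * (R * N) * (R * P) - P * R * P * R * P := by noncomm_ring
      _ = _ := by rw [hRN]; noncomm_ring
  rw [← sub_nonneg]
  calc (0 : 𝓐) ≤ (1 - P * R) * P * (1 - R * P) + P * R * (N - P) * (R * P) := add_nonneg h1 h2
    _ = P - P * R * P := by rw [h3]; noncomm_ring

/-- The operator form of `t⁻¹ + t ≤ h + h⁻¹` for `h⁻¹ ≤ t ≤ h`, with `t` the quotient of
`Y` by `X`. -/
lemma mul_inverse_mul_add_le {X Y : 𝓐} {h : ℝ} (hh : 1 < h) (hY : IsStrictlyPositive Y)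
    (hXY : X ≤ h • Y) (hYX : Y ≤ h • X) :
    X * Ring.inverse Y * X + Y ≤ (h + h⁻¹) • X := by
  have hh0 : 0 < h := by linarith
  have hk : 0 < h ^ 2 - 1 := by nlinarith
  have hYY : Y * Ring.inverse Y = 1 := Ring.mul_inverse_cancel _ hY.isUnit
  have hYY' : Ring.inverse Y * Y = 1 := Ring.inverse_mul_cancel _ hY.isUnit
  have hN : IsStrictlyPositive ((h ^ 2 - 1) • Y) := hY.smul hk
  -- `P = h X - Y` and `Q = h (h Y - X)` are nonnegative with sum `N = (h ^ 2 - 1) Y`,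
  -- and `P - P N⁻¹ P` is their parallel sum.
  have key := mul_inverse_mul_le (P := h • X - Y) (sub_nonneg.2 hYX) hN (by
    have := smul_le_smul_of_nonneg_left hXY hh0.le
    rw [← sub_nonneg] at this ⊢
    convert this using 1
    module)
  rw [ringInverse_smul hk.ne' hY.isUnit] at key
  have e : (h • X - Y) * ((h ^ 2 - 1)⁻¹ • Ring.inverse Y) * (h • X - Y)
      = (h ^ 2 - 1)⁻¹ • (h ^ 2 • (X * Ring.inverse Y * X) - (2 * h) • X + Y) := by
    rw [mul_smul_comm, smul_mul_assoc]
    congr 1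
    have e1 : X * Ring.inverse Y * Y = X := by rw [mul_assoc, hYY', mul_one]
    simp only [sub_mul, mul_sub, smul_mul_assoc, mul_smul_comm, hYY, one_mul, e1]
    module
  rw [e] at key
  have key2 := smul_le_smul_of_nonneg_left key (mul_nonneg hk.le (by positivity : 0 ≤ (h ^ 2)⁻¹))
  rw [← sub_nonneg] at key2 ⊢
  convert key2 using 1
  match_scalars <;> field_simp <;> ring

/-- The tangent line of `t ↦ t ^ p` at `c` lies below the graph. -/
lemma tangent_le_rpow {A : 𝓐} (hA : 0 ≤ A) {p c : ℝ} (hp : 1 ≤ p) (hc : 0 < c) :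
    ((1 - p) * c ^ p) • (1 : 𝓐) + (p * c ^ (p - 1)) • A ≤ A ^ p := by
  have e : ((1 - p) * c ^ p) • (1 : 𝓐) + (p * c ^ (p - 1)) • A
      = cfc (fun t : ℝ => (1 - p) * c ^ p + p * c ^ (p - 1) * t) A := by
    rw [cfc_const_add _ _ A, cfc_const_mul _ _ A, cfc_id' ℝ A, Algebra.algebraMap_eq_smul_one]
  rw [e, CFC.rpow_eq_cfc_real hA]
  refine cfc_mono (fun t ht => ?_) (by fun_prop)
    (Real.continuous_rpow_const (by linarith)).continuousOn
  have ht0 : 0 ≤ t := spectrum_nonneg_of_nonneg hA ht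
  have h := one_add_mul_self_le_rpow_one_add (s := t / c - 1)
    (by have : 0 ≤ t / c := by positivity
        linarith) hp
  rw [add_sub_cancel, Real.div_rpow ht0 hc.le, le_div_iff₀ (by positivity)] at h
  calc (1 - p) * c ^ p + p * c ^ (p - 1) * t = (1 + p * (t / c - 1)) * c ^ p := by
        rw [Real.rpow_sub_one hc.ne']; field_simp; ring
    _ ≤ t ^ p := h

lemma isStrictlyPositive_of_smul_one_le {A : 𝓐} {m : ℝ} (hm : 0 < m) (h : m • (1 : 𝓐) ≤ A) :
    IsStrictlyPositive A :=
  IsStrictlyPositive.of_le (isStrictlyPositive_one.smul hm) h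

lemma smul_one_rpow_le {A : 𝓐} {m p : ℝ} (hm : 0 < m) (hp : 0 ≤ p) (h : m • (1 : 𝓐) ≤ A) :
    m ^ p • (1 : 𝓐) ≤ A ^ p := by
  have hA : 0 ≤ A := (isStrictlyPositive_of_smul_one_le hm h).nonneg
  rw [← Algebra.algebraMap_eq_smul_one] at h ⊢
  rw [CFC.rpow_eq_cfc_real hA]
  refine algebraMap_le_cfc _ _ _ (fun t ht => ?_)
    (Real.continuous_rpow_const hp).continuousOn
  exact Real.rpow_le_rpow hm.le ((algebraMap_le_iff_le_spectrum (a := A)).1 h t ht) hp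

lemma rpow_le_smul_one {A : 𝓐} {M p : ℝ} (hA : 0 ≤ A) (hp : 0 ≤ p) (h : A ≤ M • (1 : 𝓐)) :
    A ^ p ≤ M ^ p • (1 : 𝓐) := by
  rw [← Algebra.algebraMap_eq_smul_one] at h ⊢
  rw [CFC.rpow_eq_cfc_real hA]
  refine cfc_le_algebraMap _ _ _ (fun t ht => ?_)
    (Real.continuous_rpow_const hp).continuousOn
  exact Real.rpow_le_rpow (spectrum_nonneg_of_nonneg hA ht)
    ((le_algebraMap_iff_spectrum_le (a := A)).1 h t ht) hp

lemma norm_le_of_le_smul_one {A : 𝓐} {c : ℝ} (hA : 0 ≤ A) (hc : 0 ≤ c) (h : A ≤ c • (1 : 𝓐)) :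
    ‖A‖ ≤ c := by
  rw [← Algebra.algebraMap_eq_smul_one] at h
  exact (CStarAlgebra.norm_le_iff_le_algebraMap A hc hA).2 h

lemma le_norm_smul_one {A : 𝓐} (hA : 0 ≤ A) : A ≤ ‖A‖ • (1 : 𝓐) := by
  rw [← Algebra.algebraMap_eq_smul_one]
  exact IsSelfAdjoint.le_algebraMap_norm_self hA.isSelfAdjoint

end CStarAlgebra

/-! ### Arithmetic and harmonic means of operators -/

section Means

variable {H : Type*} [NormedAddCommGroup H] [InnerProductSpace ℂ H] [CompleteSpace H]
  {v : ℝ} {A B : H →L[ℂ] H}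

lemma arith_mono (hv : v ∈ Set.Icc (0 : ℝ) 1) {C D : H →L[ℂ] H} (hAC : A ≤ C) (hBD : B ≤ D) :
    arith v A B ≤ arith v C D :=
  add_le_add (smul_le_smul_of_nonneg_left hAC (by linarith [hv.2]))
    (smul_le_smul_of_nonneg_left hBD hv.1)

omit [CompleteSpace H] in
lemma arith_self : arith v A A = A := by
  unfold arith; module

lemma arith_nonneg (hv : v ∈ Set.Icc (0 : ℝ) 1) (hA : 0 ≤ A) (hB : 0 ≤ B) : 0 ≤ arith v A B := by
  simpa only [arith_self] using arith_mono hv hA hB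

lemma isStrictlyPositive_arith (hv : v ∈ Set.Icc (0 : ℝ) 1) (hA : IsStrictlyPositive A)
    (hB : IsStrictlyPositive B) : IsStrictlyPositive (arith v A B) := by
  rcases hv.1.eq_or_lt with rfl | h0
  · simpa [arith] using hA
  · exact (hB.smul h0).nonneg_add (smul_nonneg (by linarith [hv.2]) hA.nonneg)

omit [CompleteSpace H] in
lemma harm_eq : harm v A B = Ring.inverse (arith v (Ring.inverse A) (Ring.inverse B)) := rfl

lemma isStrictlyPositive_harm (hv : v ∈ Set.Icc (0 : ℝ) 1) (hA : IsStrictlyPositive A)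
    (hB : IsStrictlyPositive B) : IsStrictlyPositive (harm v A B) :=
  (isStrictlyPositive_arith hv hA.ringInverse hB.ringInverse).ringInverse

/-- The tangent line bound, averaged over two operators. -/
lemma tangent_arith_le (hv : v ∈ Set.Icc (0 : ℝ) 1) (hA : 0 ≤ A) (hB : 0 ≤ B) {p c : ℝ}
    (hp : 1 ≤ p) (hc : 0 < c) :
    ((1 - p) * c ^ p) • (1 : H →L[ℂ] H) + (p * c ^ (p - 1)) • arith v A B ≤
      arith v (A ^ p) (B ^ p) := by
  refine le_of_eq_of_le ?_ (arith_mono hv (tangent_le_rpow hA hp hc) (tangent_le_rpow hB hp hc))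
  unfold arith
  module

lemma norm_arith_rpow_le (hv : v ∈ Set.Icc (0 : ℝ) 1) (hA : 0 ≤ A) (hB : 0 ≤ B) {p : ℝ}
    (hp : 1 ≤ p) : ‖arith v A B‖ ^ p ≤ ‖arith v (A ^ p) (B ^ p)‖ := by
  rcases (norm_nonneg (arith v A B)).eq_or_lt with h0 | h0
  · rw [← h0, Real.zero_rpow (by linarith)]
    exact norm_nonneg _
  set c := ‖arith v A B‖ with hc
  have hcp : 0 < c ^ p := Real.rpow_pos_of_pos h0 p
  have hcp1 : 0 < p * c ^ (p - 1) := mul_pos (by linarith) (Real.rpow_pos_of_pos h0 _)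
  have hS := arith_nonneg hv hA hB
  have hT : 0 ≤ arith v (A ^ p) (B ^ p) := arith_nonneg hv CFC.rpow_nonneg CFC.rpow_nonneg
  have h1 : (p * c ^ (p - 1)) • arith v A B ≤
      (‖arith v (A ^ p) (B ^ p)‖ + (p - 1) * c ^ p) • (1 : H →L[ℂ] H) := by
    have h := (tangent_arith_le hv hA hB hp h0).trans (le_norm_smul_one hT)
    rw [← sub_nonneg] at h ⊢
    convert h using 1
    module
  have h2 := norm_le_of_le_smul_one (smul_nonneg hcp1.le hS)
    (add_nonneg (norm_nonneg _) (mul_nonneg (by linarith) hcp.le)) h1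
  rw [norm_smul, Real.norm_of_nonneg hcp1.le, ← hc, mul_assoc, ← Real.rpow_add_one h0.ne',
    sub_add_cancel] at h2
  linarith

omit [CompleteSpace H] in
lemma ringInverse_smul_one {c : ℝ} (hc : c ≠ 0) :
    Ring.inverse (c • (1 : H →L[ℂ] H)) = c⁻¹ • (1 : H →L[ℂ] H) := by
  rw [ringInverse_smul hc isUnit_one, Ring.inverse_one]

lemma ringInverse_le_smul_one {c : ℝ} (hc : 0 < c) (h : c • (1 : H →L[ℂ] H) ≤ A) :
    Ring.inverse A ≤ c⁻¹ • (1 : H →L[ℂ] H) := by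
  rw [← ringInverse_smul_one hc.ne']
  exact CStarAlgebra.antitoneOn_ringInverse (isStrictlyPositive_one.smul hc)
    (isStrictlyPositive_of_smul_one_le hc h) h

lemma smul_one_le_ringInverse {c : ℝ} (hc : 0 < c) (hA : IsStrictlyPositive A)
    (h : A ≤ c • (1 : H →L[ℂ] H)) : c⁻¹ • (1 : H →L[ℂ] H) ≤ Ring.inverse A := by
  rw [← ringInverse_smul_one hc.ne']
  exact CStarAlgebra.antitoneOn_ringInverse hA (isStrictlyPositive_one.smul hc) h

lemma norm_harm_rpow_le (hv : v ∈ Set.Icc (0 : ℝ) 1) (hA : IsStrictlyPositive A)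
    (hB : IsStrictlyPositive B) {p : ℝ} (hp : 1 ≤ p) :
    ‖harm v (A ^ p) (B ^ p)‖ ≤ ‖harm v A B‖ ^ p := by
  rcases subsingleton_or_nontrivial (H →L[ℂ] H) with hs | hs
  · rw [Subsingleton.elim (harm v (A ^ p) (B ^ p)) 0, norm_zero]
    positivity
  have hh := isStrictlyPositive_harm hv hA hB
  have hW := isStrictlyPositive_arith hv hA.ringInverse hB.ringInverse
  have hn : 0 < ‖harm v A B‖ := norm_pos_iff.2 hh.isUnit.ne_zero
  set c := ‖harm v A B‖⁻¹ with hc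
  have hc0 : 0 < c := inv_pos.2 hn
  have h1 : c • (1 : H →L[ℂ] H) ≤ arith v (Ring.inverse A) (Ring.inverse B) := by
    have := smul_one_le_ringInverse hn hh (le_norm_smul_one hh.nonneg)
    rwa [harm_eq, Ring.inverse_inverse hW.isUnit] at this
  have h2 : c ^ p • (1 : H →L[ℂ] H) ≤
      arith v (Ring.inverse (A ^ p)) (Ring.inverse (B ^ p)) := by
    rw [ringInverse_rpow hA (by linarith), ringInverse_rpow hB (by linarith)]
    refine le_trans ?_ (tangent_arith_le hv hA.ringInverse.nonneg hB.ringInverse.nonneg hp hc0)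
    have h3 := smul_le_smul_of_nonneg_left h1
      (mul_nonneg (by linarith) (Real.rpow_nonneg hc0.le _) : 0 ≤ p * c ^ (p - 1))
    refine le_of_eq_of_le ?_ (add_le_add_right h3 _)
    rw [smul_smul, ← add_smul, mul_assoc, ← Real.rpow_add_one hc0.ne', sub_add_cancel]
    congr 1
    ring
  have h4 := ringInverse_le_smul_one (Real.rpow_pos_of_pos hc0 p) h2
  rw [← harm_eq, hc, Real.inv_rpow hn.le, inv_inv] at h4
  exact norm_le_of_le_smul_one (isStrictlyPositive_harm hv (hA.rpow _ _) (hB.rpow _ _)).nonneg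
    (by positivity) h4

/-- A reverse arithmetic-harmonic mean inequality for comparable operators. -/
lemma arith_le_smul_harm (hv : v ∈ Set.Icc (0 : ℝ) 1) (hA : IsStrictlyPositive A)
    (hB : IsStrictlyPositive B) {h : ℝ} (hh : 1 < h) (hAB : A ≤ h • B) (hBA : B ≤ h • A) :
    arith v A B ≤ ((1 - v) ^ 2 + v ^ 2 + v * (1 - v) * (h + h⁻¹)) • harm v A B := by
  set K := (1 - v) ^ 2 + v ^ 2 + v * (1 - v) * (h + h⁻¹) with hK
  set S := arith v A B with hS
  set W := arith v (Ring.inverse A) (Ring.inverse B) with hW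
  have hSp : IsStrictlyPositive S := isStrictlyPositive_arith hv hA hB
  have hWp : IsStrictlyPositive W := isStrictlyPositive_arith hv hA.ringInverse hB.ringInverse
  have hvv : 0 ≤ v * (1 - v) := mul_nonneg hv.1 (by linarith [hv.2])
  have hK0 : 0 < K := by
    have : 0 ≤ v * (1 - v) * (h + h⁻¹) := mul_nonneg hvv (by positivity)
    nlinarith [sq_nonneg (1 - 2 * v)]
  have hSWS : S * W * S ≤ K • S := by
    have h1 := smul_le_smul_of_nonneg_left (mul_inverse_mul_add_le hh hB hAB hBA)
      (mul_nonneg hvv (by linarith [hv.2] : 0 ≤ 1 - v))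
    have h2 := smul_le_smul_of_nonneg_left (mul_inverse_mul_add_le hh hA hBA hAB)
      (mul_nonneg hvv hv.1)
    have h3 := add_le_add h1 h2
    have a1 : A * Ring.inverse A = 1 := Ring.mul_inverse_cancel _ hA.isUnit
    have a2 : B * Ring.inverse B = 1 := Ring.mul_inverse_cancel _ hB.isUnit
    have a3 : A * Ring.inverse B * B = A := by
      rw [mul_assoc, Ring.inverse_mul_cancel _ hB.isUnit, mul_one]
    have a4 : B * Ring.inverse A * A = B := by
      rw [mul_assoc, Ring.inverse_mul_cancel _ hA.isUnit, mul_one]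
    have e : S * W * S = ((1 - v) ^ 2 + v ^ 2) • S + (v * (1 - v)) • S +
        ((v * (1 - v) * (1 - v)) • (A * Ring.inverse B * A + B) +
          (v * (1 - v) * v) • (B * Ring.inverse A * B + A)) -
        (v * (1 - v)) • S := by
      rw [hS, hW]
      unfold arith
      simp only [add_mul, mul_add, smul_mul_assoc, mul_smul_comm, a1, a2, a3, a4, one_mul]
      module
    rw [e]
    rw [← sub_nonneg] at h3 ⊢
    convert h3 using 1
    rw [hS, hK]
    unfold arith
    module
  -- Cancelling `S` on both sides gives `W ≤ K S⁻¹`, and inverting gives `S ≤ K W⁻¹`.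
  have hW2 : W ≤ K • Ring.inverse S := by
    have := hSp.ringInverse.isSelfAdjoint.conjugate_le_conjugate hSWS
    have s1 : S * Ring.inverse S = 1 := Ring.mul_inverse_cancel _ hSp.isUnit
    have s2 : Ring.inverse S * S = 1 := Ring.inverse_mul_cancel _ hSp.isUnit
    rw [mul_smul_comm, smul_mul_assoc, s2, one_mul] at this
    refine le_of_eq_of_le ?_ this
    calc W = (Ring.inverse S * S) * W * (S * Ring.inverse S) := by
          rw [s1, s2, one_mul, mul_one]
      _ = _ := by noncomm_ring
  have h5 := CStarAlgebra.antitoneOn_ringInverse hWp (hSp.ringInverse.smul hK0) hW2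
  rw [ringInverse_smul hK0.ne' hSp.ringInverse.isUnit, Ring.inverse_inverse hSp.isUnit] at h5
  have h6 := smul_le_smul_of_nonneg_left h5 hK0.le
  rwa [smul_smul, mul_inv_cancel₀ hK0.ne', one_smul] at h6

lemma norm_arith_le_mul_norm_harm (hv : v ∈ Set.Icc (0 : ℝ) 1) {a b : ℝ} (ha : 0 < a)
    (hab : a < b) (haA : a • (1 : H →L[ℂ] H) ≤ A) (hAb : A ≤ b • (1 : H →L[ℂ] H))
    (haB : a • (1 : H →L[ℂ] H) ≤ B) (hBb : B ≤ b • (1 : H →L[ℂ] H)) :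
    ‖arith v A B‖ ≤ constL v a b * ‖harm v A B‖ := by
  have hA := isStrictlyPositive_of_smul_one_le ha haA
  have hB := isStrictlyPositive_of_smul_one_le ha haB
  have hb : 0 < b := ha.trans hab
  have comparable : ∀ {X Y : H →L[ℂ] H}, X ≤ b • (1 : H →L[ℂ] H) → a • (1 : H →L[ℂ] H) ≤ Y →
      X ≤ (b / a) • Y := fun hX hY => by
    have := smul_le_smul_of_nonneg_left hY (div_pos hb ha).le
    rw [smul_smul, div_mul_cancel₀ _ ha.ne'] at this
    exact hX.trans this
  have h := CStarAlgebra.norm_le_norm_of_nonneg_of_le (arith_nonneg hv hA.nonneg hB.nonneg)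
    (arith_le_smul_harm hv hA hB ((one_lt_div ha).2 hab) (comparable hAb haB)
      (comparable hBb haA))
  have hK0 : 0 ≤ (1 - v) ^ 2 + v ^ 2 + v * (1 - v) * (b / a + (b / a)⁻¹) := by
    have : 0 ≤ v * (1 - v) := mul_nonneg hv.1 (by linarith [hv.2])
    positivity
  rw [norm_smul, Real.norm_of_nonneg hK0] at h
  exact h.trans (mul_le_mul_of_nonneg_right (kantorovich_le_constL ha hab.le hv) (norm_nonneg _))

lemma IsBetweenHarmArith.norm_le {σ : (H →L[ℂ] H) → (H →L[ℂ] H) → (H →L[ℂ] H)}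
    (hσ : IsBetweenHarmArith v σ) (hv : v ∈ Set.Icc (0 : ℝ) 1) (hA : IsStrictlyPositive A)
    (hB : IsStrictlyPositive B) :
    ‖harm v A B‖ ≤ ‖σ A B‖ ∧ ‖σ A B‖ ≤ ‖arith v A B‖ := by
  obtain ⟨h1, h2⟩ := hσ A B hA.nonneg hA.isUnit hB.nonneg hB.isUnit
  have h0 := (isStrictlyPositive_harm hv hA hB).nonneg
  exact ⟨CStarAlgebra.norm_le_norm_of_nonneg_of_le h0 h1,
    CStarAlgebra.norm_le_norm_of_nonneg_of_le (h0.trans h1) h2⟩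

end Means

end OpMean

/-! ### The norm inequalities -/

theorem mainTheorem3 {H : Type*} [NormedAddCommGroup H] [InnerProductSpace ℂ H] [CompleteSpace H]
    (m M : ℝ) (hm : 0 < m) (hmM : m < M)
    (A B : H →L[ℂ] H)
    (hmA : m • (1 : H →L[ℂ] H) ≤ A) (hAM : A ≤ M • (1 : H →L[ℂ] H))
    (hmB : m • (1 : H →L[ℂ] H) ≤ B) (hBM : B ≤ M • (1 : H →L[ℂ] H))
    (v : ℝ) (hv : v ∈ Set.Icc (0 : ℝ) 1)
    (σ τ : (H →L[ℂ] H) → (H →L[ℂ] H) → (H →L[ℂ] H))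
    (hσ : OpMean.IsOperatorMean σ) (hσv : OpMean.IsBetweenHarmArith v σ)
    (hτ : OpMean.IsOperatorMean τ) (hτv : OpMean.IsBetweenHarmArith v τ)
    (p : ℝ) (hp : 1 < p) :
    ‖σ A B‖ ^ p ≤ OpMean.constL v (m ^ p) (M ^ p) * ‖τ (A ^ p) (B ^ p)‖ ∧
    ‖σ (A ^ p) (B ^ p)‖ ≤ OpMean.constL v (m ^ p) (M ^ p) * ‖τ A B‖ ^ p := by
  have hA := OpMean.isStrictlyPositive_of_smul_one_le hm hmA
  have hB := OpMean.isStrictlyPositive_of_smul_one_le hm hmB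
  have hp0 : 0 ≤ p := by linarith
  have hAp : IsStrictlyPositive (A ^ p) := hA.rpow A p
  have hBp : IsStrictlyPositive (B ^ p) := hB.rpow B p
  have hrev := OpMean.norm_arith_le_mul_norm_harm hv (Real.rpow_pos_of_pos hm p)
    (Real.rpow_lt_rpow hm.le hmM (by linarith))
    (OpMean.smul_one_rpow_le hm hp0 hmA) (OpMean.rpow_le_smul_one hA.nonneg hp0 hAM)
    (OpMean.smul_one_rpow_le hm hp0 hmB) (OpMean.rpow_le_smul_one hB.nonneg hp0 hBM)
  have hL : 0 ≤ OpMean.constL v (m ^ p) (M ^ p) := by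
    have h1 := OpMean.kantorovich_le_constL (Real.rpow_pos_of_pos hm p)
      (Real.rpow_le_rpow hm.le hmM.le hp0) hv
    have h2 : 0 ≤ v * (1 - v) := mul_nonneg hv.1 (by linarith [hv.2])
    have hM : 0 < M := hm.trans hmM
    exact le_trans (by positivity) h1
  constructor
  · calc ‖σ A B‖ ^ p ≤ ‖OpMean.arith v A B‖ ^ p :=
          Real.rpow_le_rpow (norm_nonneg _) (hσv.norm_le hv hA hB).2 hp0
      _ ≤ ‖OpMean.arith v (A ^ p) (B ^ p)‖ :=
          OpMean.norm_arith_rpow_le hv hA.nonneg hB.nonneg hp.le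
      _ ≤ _ := hrev
      _ ≤ _ := mul_le_mul_of_nonneg_left (hτv.norm_le hv hAp hBp).1 hL
  · calc ‖σ (A ^ p) (B ^ p)‖ ≤ ‖OpMean.arith v (A ^ p) (B ^ p)‖ := (hσv.norm_le hv hAp hBp).2
      _ ≤ _ := hrev
      _ ≤ OpMean.constL v (m ^ p) (M ^ p) * ‖τ A B‖ ^ p := by
          refine mul_le_mul_of_nonneg_left ?_ hL
          exact (OpMean.norm_harm_rpow_le hv hA hB hp.le).trans
            (Real.rpow_le_rpow (norm_nonneg _) (hτv.norm_le hv hA hB).1 hp0)
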